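/- Let $H_n$ be the classical Hermite polynomials ($H_0=1$, $H_{n+1}=2xH_n-H_n'$) and let $\operatorname{Wr}$ denote the Wronskian determinant. A partition is a finite non-decreasing sequence $\lambda=(\lambda_1\le\dots\le\lambda_\ell)$ of non-negative integers; put $k_i=\lambda_i+i-1$ and $K_\lambda=\{k_1,\dots,k_\ell\}$, and define $$H_\lambda=\operatorname{Wr}[H_{k_1},\dots,H_{k_\ell}],\qquad H_{\lambda,j}=\operatorname{Wr}[H_{k_1},\dots,H_{k_\ell},H_j]\quad (j\in\mathbb N\setminus K_\lambda),$$ $$\mathcal U_\lambda=\operatorname{span}\{H_{\lambda,j}: j\in\mathbb N\setminus K_\lambda\},\qquad W_\lambda(x)=\frac{e^{-x^2}}{H_\lambda(x)^2}.$$ For a partition $\mu=(\mu_1,\dots,\mu_r)$ let $\mu^2=(\mu_1,\mu_1,\mu_2,\mu_2,\dots,\mu_r,\mu_r)$. An Adler partition is a partition of the form $\mu^2$, possibly preceded by a string of zeros of arbitrary length. **Proposition.** Let $\lambda$ be an Adler partition. Then $H_\lambda$ has no real zeros, $\mathcal U_\lambda$ is contained in the real Hilbert space $\mathrm L^2(\mathbb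 R,W_\lambda\,dx)$, and $\mathcal U_\lambda$ is dense in it. Moreover, the polynomials $H_{\lambda,j}$, $j\in\mathbb N\setminus K_\lambda$, form a complete orthogonal basis of $\mathrm L^2(\mathbb R,W_\lambda\,dx)$. In particular, for every partition $\mu$, the $\mathrm X_\mu$-Hermite polynomials $H^{(\mu)}_j=H_{\mu^2,j}$, $j\in\mathbb N\setminus K_{\mu^2}$, form a complete orthogonal basis of $\mathrm L^2(\mathbb R,W_{\mu^2}\,dx)$. -/

import Mathlib

namespace XHermite

open Polynomial MeasureTheory

noncomputable section

/-- The classical (physicists') Hermite polynomials, `H₀ = 1`, `Hₙ₊₁ = 2 x Hₙ - Hₙ'`, orthogonal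
with respect to `exp (-x²)`. -/
def hermiteH : ℕ → ℝ[X]
  | 0 => 1
  | n + 1 => 2 * X * hermiteH n - derivative (hermiteH n)

/-- The Wronskian determinant `Wr[f₁, …, fₙ]` of polynomials: row `i` holds the derivatives of
order `i`. -/
def wr {n : ℕ} (f : Fin n → ℝ[X]) : ℝ[X] :=
  (Matrix.of fun i j : Fin n => derivative^[(i : ℕ)] (f j)).det

/-- A partition: a finite non-decreasing sequence of non-negative integers (initial zeros are
allowed, and so is the empty sequence). -/
def IsPartition (lam : List ℕ) : Prop :=
  lam.Pairwise (· ≤ ·)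

/-- The double partition `(λ₁, λ₁, λ₂, λ₂, …, λ_ℓ, λ_ℓ)`. -/
def double (mu : List ℕ) : List ℕ :=
  mu.flatMap fun a => [a, a]

/-- An Adler partition: a double partition, possibly preceded by a string of zeros. -/
def IsAdlerPartition (lam : List ℕ) : Prop :=
  ∃ (z : ℕ) (mu : List ℕ), IsPartition mu ∧ lam = List.replicate z 0 ++ double mu

/-- The gap sequence `kᵢ = λᵢ + i - 1` (`i = 1, …, ℓ`), here indexed from `0`. -/
def gap (lam : List ℕ) (i : Fin lam.length) : ℕ :=
  lam.get i + i

/-- The set `{k₁, …, k_ℓ}`. -/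
def gapSet (lam : List ℕ) : Set ℕ :=
  Set.range (gap lam)

/-- `H_λ = Wr[H_{k₁}, …, H_{k_ℓ}]`. -/
def hermiteWr (lam : List ℕ) : ℝ[X] :=
  wr fun i => hermiteH (gap lam i)

/-- `H_{λ,j} = Wr[H_{k₁}, …, H_{k_ℓ}, H_j]`. -/
def hermiteWrAdd (lam : List ℕ) (j : ℕ) : ℝ[X] :=
  wr (n := lam.length + 1)
    (Fin.snoc (α := fun _ => ℝ[X]) (fun i => hermiteH (gap lam i)) (hermiteH j))

/-- The `X_μ`-Hermite polynomials `H^{(μ)}_j = H_{μ²,j}`, used for `j` outside the gap sequence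
of `μ²`. -/
def xHermite (mu : List ℕ) (j : ℕ) : ℝ[X] :=
  hermiteWrAdd (double mu) j

/-- The exceptional subspace `U_λ = span {H_{λ,j} : j ∉ {k₁, …, k_ℓ}}`. -/
def exceptionalSubspace (lam : List ℕ) : Submodule ℝ ℝ[X] :=
  Submodule.span ℝ {q | ∃ j, j ∉ gapSet lam ∧ q = hermiteWrAdd lam j}

/-- The measure `W_λ(x) dx` on `ℝ`, where `W_λ(x) = exp (-x²) / H_λ(x)²`. -/
def weightMeasure (lam : List ℕ) : Measure ℝ :=
  volume.withDensity fun x =>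
    ENNReal.ofReal (Real.exp (-x ^ 2) / (hermiteWr lam).eval x ^ 2)

/-- The polynomials `P i` form a complete orthogonal basis of the real Hilbert space `L²(ℝ, m)`:
after multiplication by positive constants they are a Hilbert basis (a complete orthonormal
system). -/
def IsCompleteOrthogonalBasis (m : Measure ℝ) {ι : Type} (P : ι → ℝ[X]) : Prop :=
  ∃ b : HilbertBasis ι ℝ (Lp ℝ 2 m),
    ∀ i, ∃ c : ℝ, 0 < c ∧ (b i : ℝ → ℝ) =ᵐ[m] fun x => c * (P i).eval x

end

end XHermite

namespace XHermite

open Polynomial MeasureTheory Filter Topology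

noncomputable section

/-! Once `H_λ` has no real zeros, the rest follows for any family of distinct or repeated Hermite
indices. Write `W = H_λ`, and let `V`, `U`, `Y` be `W` with `H_i`, with `H_j`, and with both
adjoined. The Hermite equation and repeated Darboux transformations give `(e^{-x²} Y / W)' = (2i -
2j) e^{-x²} V U / W²` (`wr_hermiteH_bilinear`), whose integral over `ℝ` is orthogonality.

Completeness: a function orthogonal to all `H_{λ,j}` is orthogonal to `Wr[φ, p]` for every
polynomial `p`, since the Hermite polynomials span. By variation of parameters these include all
multiples of `W²` (`exists_wr_snoc_eq`). The factor `W²` cancels the denominator of the weight, so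
all moments of `f e^{-x²}` vanish and `f = 0`.

Absence of zeros (`wr_hermiteH_eval_ne_zero`): the indices form disjoint pairs `k, k + 1`. A zero at
`a` yields a nonzero combination `f` of the `H_{k_i}` vanishing to order `ℓ` at `a`. With `L = 2x
d/dx - d²/dx²`, put `L₁ = ∏ (L - 2k)` and `L₂ = ∏ (L - 2k - 2)`; then `L₁ L₂ f = 0`. The vanishing
at `a` removes boundary terms on `(a, ∞)`, so `0 = ⟨L₁ f, L₂ f⟩`. By Parseval this is a sum of
squares with weights `∏ (2n - 2k)(2n - 2k - 2) ≥ 0`, positive off the indices. Hence the truncation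
of `f` to `(a, ∞)` has a finite Hermite expansion, so is a polynomial a.e., which forces `f = 0`.
Leading zeros in `λ` only rescale `H_λ`. -/

/-! ### Wronskians for a derivation: Darboux reduction and the bilinear identity. -/

/-- The Wronskian determinant with respect to an arbitrary map `D`. -/
def wronskian {R : Type*} [CommRing R] (D : R → R) {n : ℕ} (f : Fin n → R) : R :=
  (Matrix.of fun i j : Fin n => D^[(i : ℕ)] (f j)).det

/-- The coefficients do not depend on `f`, so the passage from the rows `D^i f` to the rows `D^i (D
f - s f)` is a unipotent row operation. -/
theorem exists_iterate_darboux {k R : Type*} [CommRing k] [CommRing R] [Algebra k R]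
    (D : Derivation k R R) (s : R) (i : ℕ) :
    ∃ c : ℕ → R, ∀ f : R, D^[i] (D f - s * f) =
      D^[i + 1] f + ∑ j ∈ Finset.range (i + 1), c j * D^[j] f := by
  induction i with
  | zero => exact ⟨fun _ => -s, fun f => by simp; ring⟩
  | succ i ih =>
    obtain ⟨c, hc⟩ := ih
    -- Leibniz: a term either has its coefficient differentiated (indices up to `i`) or its order
    -- raised (indices from `1`).
    refine ⟨fun j => (if j = i + 1 then 0 else D (c j)) + (if j = 0 then 0 else c (j - 1)),
      fun f => ?_⟩
    rw [Function.iterate_succ_apply', hc, map_add, map_sum, ← Function.iterate_succ_apply' D]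
    congr 1
    simp only [add_mul, Finset.sum_add_distrib]
    rw [Finset.sum_range_succ (fun j => (if j = i + 1 then 0 else D (c j)) * D^[j] f),
      Finset.sum_range_succ' (fun j => (if j = 0 then 0 else c (j - 1)) * D^[j] f)]
    simp only [if_true, zero_mul, add_zero, Nat.add_sub_cancel, Nat.add_eq_zero_iff, one_ne_zero,
      and_false, if_false]
    rw [← Finset.sum_add_distrib]
    refine Finset.sum_congr rfl fun j hj => ?_
    rw [if_neg (Finset.mem_range.1 hj).ne, D.leibniz, smul_eq_mul, smul_eq_mul,
      ← Function.iterate_succ_apply' D]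
    ring

/-- `D - s` kills `p`, so after the row operation the first column is `(p, 0, …, 0)`. -/
theorem wronskian_cons {k R : Type*} [CommRing k] [CommRing R] [Algebra k R]
    (D : Derivation k R R) {p s : R}
    (hs : D p = s * p) {n : ℕ} (f : Fin n → R) :
    wronskian D (Fin.cons p f : Fin (n + 1) → R) =
      p * wronskian D fun i => D (f i) - s * f i := by
  choose c hc using exists_iterate_darboux D s
  -- Row `0` keeps the functions themselves; row `i + 1` holds the coefficients of `D^i (D - s)`.
  let U : Matrix (Fin (n + 1)) (Fin (n + 1)) R := Matrix.of fun i j =>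
    Fin.cases (if j = 0 then 1 else 0)
      (fun i' : Fin n => if (j : ℕ) = i' + 1 then 1 else if (j : ℕ) ≤ i' then c i' j else 0) i
  let M : Matrix (Fin (n + 1)) (Fin (n + 1)) R :=
    Matrix.of fun i j => D^[(i : ℕ)] ((Fin.cons p f : Fin (n + 1) → R) j)
  have hU : U.det = 1 := by
    rw [Matrix.det_of_isLowerTriangular]
    · refine Finset.prod_eq_one fun i _ => ?_
      refine Fin.cases ?_ (fun i' => ?_) i <;> simp [U]
    · intro i j hij
      have hij : (i : ℕ) < j := hij
      refine Fin.cases (fun h => ?_) (fun i' h => ?_) i hij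
      · simp only [U, Matrix.of_apply, Fin.cases_zero]
        rw [if_neg]
        rintro rfl
        simp at h
      · simp only [Fin.val_succ] at h
        simp only [U, Matrix.of_apply, Fin.cases_succ]
        rw [if_neg (by omega), if_neg (by omega)]
  have row0 : ∀ j, (U * M) 0 j = (Fin.cons p f : Fin (n + 1) → R) j := by
    intro j
    simp [Matrix.mul_apply, U, M]
  have rowS : ∀ (i : Fin n) j, (U * M) i.succ j =
      D^[(i : ℕ)] (D ((Fin.cons p f : Fin (n + 1) → R) j)
        - s * (Fin.cons p f : Fin (n + 1) → R) j) := by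
    intro i j
    rw [hc, Matrix.mul_apply]
    simp only [U, M, Matrix.of_apply, Fin.cases_succ]
    rw [Fin.sum_univ_eq_sum_range (fun k => (if k = (i : ℕ) + 1 then 1 else
        if k ≤ (i : ℕ) then c i k else 0) * D^[k] ((Fin.cons p f : Fin (n + 1) → R) j)) (n + 1)]
    rw [← Finset.sum_subset (Finset.range_mono (by omega : (i : ℕ) + 2 ≤ n + 1))]
    · rw [Finset.sum_range_succ, add_comm]
      congr 1
      · simp
      · refine Finset.sum_congr rfl fun k hk => ?_
        have := Finset.mem_range.1 hk
        rw [if_neg (by omega), if_pos (by omega)]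
    · intro k _ hk
      have : ¬ k < (i : ℕ) + 2 := fun h => hk (Finset.mem_range.2 h)
      rw [if_neg (by omega), if_neg (by omega), zero_mul]
  have h1 : wronskian D (Fin.cons p f : Fin (n + 1) → R) = (U * M).det := by
    rw [Matrix.det_mul, hU, one_mul]; rfl
  rw [h1, Matrix.det_succ_column_zero, Fin.sum_univ_succ]
  have hz : ∀ i : Fin n, (U * M) i.succ 0 = 0 := fun i => by
    rw [rowS]
    simp only [Fin.cons_zero, hs, sub_self]
    exact Function.iterate_fixed (map_zero D) _
  simp only [hz, mul_zero, zero_mul, Finset.sum_const_zero, add_zero, row0, Fin.cons_zero,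
    Fin.val_zero, pow_zero, one_mul]
  congr 2
  ext i j
  simp only [Matrix.submatrix_apply, Fin.zero_succAbove, rowS, Fin.cons_succ, Matrix.of_apply]

/-- Induction on the number of seed functions. With none, this is the usual computation of `(f g' -
g f')'`. Otherwise the first seed is removed by a Darboux transformation, which preserves the form
of the equations and the eigenvalues and changes only the potential `v`. -/
theorem wronskian_bilinear {k F : Type*} [CommRing k] [Field F] [Algebra k F]
    (D : Derivation k F F) {n : ℕ} :
    ∀ (a v : F) (φ : Fin n → F) (E : Fin n → F) (f g Ef Eg : F),
      (∀ i, D (E i) = 0) → D Ef = 0 → D Eg = 0 →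
      (∀ i, D (D (φ i)) = a * D (φ i) + (v - E i) * φ i) →
      D (D f) = a * D f + (v - Ef) * f → D (D g) = a * D g + (v - Eg) * g →
      D (wronskian D (Fin.snoc (α := fun _ => F) (Fin.snoc (α := fun _ => F) φ f) g)) *
          wronskian D φ -
        wronskian D (Fin.snoc (α := fun _ => F) (Fin.snoc (α := fun _ => F) φ f) g) *
          D (wronskian D φ) -
        a * wronskian D (Fin.snoc (α := fun _ => F) (Fin.snoc (α := fun _ => F) φ f) g) *
          wronskian D φ =
      (Ef - Eg) * wronskian D (Fin.snoc (α := fun _ => F) φ f) *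
        wronskian D (Fin.snoc (α := fun _ => F) φ g) := by
  induction n with
  | zero =>
    intro a v φ E f g Ef Eg _ _ _ _ hf hg
    have h1 : ∀ x : F, wronskian D (Fin.snoc (α := fun _ => F) φ x) = x := fun x => by
      simp [wronskian, Matrix.det_unique, Fin.snoc]
    have h2 : wronskian D (Fin.snoc (α := fun _ => F) (Fin.snoc (α := fun _ => F) φ f) g) =
        f * D g - g * D f := by
      simp [wronskian, Matrix.det_fin_two, Fin.snoc]
    have h0 : wronskian D φ = 1 := by simp [wronskian]
    rw [h2, h1, h1, h0]
    simp only [map_sub, D.leibniz, hf, hg, smul_eq_mul, D.map_one_eq_zero]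
    ring
  | succ n ih =>
    intro a v φ E f g Ef Eg hE hEf hEg hφ hf hg
    obtain ⟨p, ψ, rfl⟩ : ∃ p ψ, φ = Fin.cons p ψ := ⟨φ 0, Fin.tail φ, (Fin.cons_self_tail φ).symm⟩
    obtain ⟨e, G, rfl⟩ : ∃ p ψ, E = Fin.cons p ψ := ⟨E 0, Fin.tail E, (Fin.cons_self_tail E).symm⟩
    have hp := hφ 0
    have he := hE 0
    have hψ := fun i => hφ (Fin.succ i)
    have hG := fun i => hE (Fin.succ i)
    simp only [Fin.cons_zero, Fin.cons_succ] at hp he hψ hG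
    -- The logarithmic derivative of `p` satisfies a Riccati equation; if `p = 0`, both sides of the
    -- identity vanish.
    have key : ∃ s, D p = s * p ∧ (p = 0 ∨ D s = a * s + v - e - s ^ 2) := by
      by_cases h0 : p = 0
      · exact ⟨0, by simp [h0], Or.inl h0⟩
      · refine ⟨D p / p, by field_simp, Or.inr ?_⟩
        have h1 : D p = D p / p * p := by field_simp
        have h2 : D (D p) = D (D p / p * p) := by rw [← h1]
        rw [D.leibniz, hp, smul_eq_mul, smul_eq_mul] at h2
        generalize D (D p / p) = z at *
        field_simp
        rw [div_mul_eq_mul_div, eq_comm, ← sub_eq_zero] at h2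
        field_simp at h2
        linear_combination h2
    obtain ⟨s, hs, hs'⟩ := key
    rw [← Fin.cons_snoc_eq_snoc_cons, ← Fin.cons_snoc_eq_snoc_cons,
      ← Fin.cons_snoc_eq_snoc_cons, wronskian_cons D hs, wronskian_cons D hs,
      wronskian_cons D hs, wronskian_cons D hs]
    rcases hs' with rfl | hs'
    · simp
    have comp : ∀ {m : ℕ} (χ : Fin m → F) (x : F), (fun i => D (Fin.snoc (α := fun _ => F) χ x i) -
        s * Fin.snoc (α := fun _ => F) χ x i) =
        Fin.snoc (α := fun _ => F) (fun i => D (χ i) - s * χ i) (D x - s * x) := by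
      intro m χ x
      ext i
      refine Fin.lastCases ?_ (fun i => ?_) i <;> simp
    have step : ∀ x X : F, D X = 0 → D (D x) = a * D x + (v - X) * x →
        D (D (D x - s * x)) = a * D (D x - s * x) +
          ((D a - D s + e - s * a + s ^ 2) - X) * (D x - s * x) := by
      intro x X hX hx
      have h1 : D (D x - s * x) = (a - s) * (D x - s * x) + (e - X) * x := by
        rw [map_sub, D.leibniz, hx, hs', smul_eq_mul, smul_eq_mul]; ring
      rw [h1]
      simp only [map_add, map_sub, D.leibniz, smul_eq_mul, hX, he, hx]
      ring_nf
      simp only [hs']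
      ring
    have := ih a (D a - D s + e - s * a + s ^ 2) (fun i => D (ψ i) - s * ψ i) G
      (D f - s * f) (D g - s * g) Ef Eg hG hEf hEg (fun i => step _ _ (hG i) (hψ i))
      (step _ _ hEf hf) (step _ _ hEg hg)
    rw [comp, comp, comp]
    simp only [D.leibniz, smul_eq_mul]
    linear_combination p ^ 2 * this

/-! ### Hermite polynomials and transfer through rational functions. -/

/-- The derivation of the field of rational functions that extends `d/dX`. -/
theorem exists_derivation_fractionRing :
    ∃ D : Derivation ℝ (FractionRing ℝ[X]) (FractionRing ℝ[X]),
      ∀ p : ℝ[X], D (algebraMap _ _ p) = algebraMap _ _ (derivative p) := by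
  let F := FractionRing ℝ[X]
  let ι : ℝ[X] →+* F := algebraMap _ _
  -- A derivation is a ring homomorphism `p ↦ p + ε p'` into the dual numbers; it extends to
  -- fractions because an element with invertible first component is a unit.
  let φ : ℝ[X] →+* DualNumber F :=
    { toFun := fun p => TrivSqZeroExt.inl (ι p) + TrivSqZeroExt.inr (ι (derivative p))
      map_one' := by ext <;> simp
      map_zero' := by ext <;> simp
      map_add' := fun p q => by ext <;> simp <;> ring
      map_mul' := fun p q => by ext <;> simp <;> ring }
  have hφ1 : ∀ p, (φ p).fst = ι p := fun p => by simp [φ]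
  have hφ2 : ∀ p, (φ p).snd = ι (derivative p) := fun p => by simp [φ]
  have hu : ∀ y : nonZeroDivisors ℝ[X], IsUnit (φ y) := fun y => by
    rw [TrivSqZeroExt.isUnit_iff_isUnit_fst, hφ1]
    exact IsLocalization.map_units F y
  let Φ : F →+* DualNumber F := IsLocalization.lift hu
  have hΦ : ∀ p, Φ (ι p) = φ p := fun p => IsLocalization.lift_eq hu p
  have hfst : ∀ x, (Φ x).fst = x := by
    have : ((TrivSqZeroExt.fstHom F F F : DualNumber F →ₐ[F] F) : DualNumber F →+* F).comp Φ =
        RingHom.id F := by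
      refine IsLocalization.ringHom_ext (nonZeroDivisors ℝ[X]) ?_
      refine RingHom.ext fun p => ?_
      exact (congrArg TrivSqZeroExt.fst (hΦ p)).trans (hφ1 p)
    exact fun x => congrArg (fun h : F →+* F => h x) this
  have hsmul : ∀ (c : ℝ) (x : F), c • x = ι (C c) * x := fun c x => by
    rw [Algebra.smul_def]; rfl
  have hmul : ∀ a b, (Φ (a * b)).snd = a * (Φ b).snd + b * (Φ a).snd := fun a b => by
    rw [map_mul, TrivSqZeroExt.snd_mul, hfst, hfst]
    simp [mul_comm]
  refine ⟨Derivation.mk' ⟨⟨fun x => (Φ x).snd, fun a b => by simp⟩, fun c x => ?_⟩ hmul,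
    fun p => (congrArg TrivSqZeroExt.snd (hΦ p)).trans (hφ2 p)⟩
  have h2 : (Φ (ι (C c))).snd = 0 := by rw [hΦ, hφ2]; simp
  simp only [hsmul, hmul, h2, mul_zero, add_zero, RingHom.id_apply]

theorem derivative_hermiteH_succ (n : ℕ) :
    derivative (hermiteH (n + 1)) = C (2 * ((n : ℝ) + 1)) * hermiteH n := by
  induction n with
  | zero => simp [hermiteH, ← C_ofNat]
  | succ n ih =>
    rw [hermiteH, map_sub, derivative_mul, ih, derivative_mul, hermiteH]
    simp only [map_mul, map_add, map_one, Nat.cast_add, Nat.cast_one, derivative_mul,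
      derivative_X, derivative_ofNat, map_natCast, map_ofNat]
    simp
    ring

theorem derivative_derivative_hermiteH (n : ℕ) :
    derivative (derivative (hermiteH n)) =
      2 * X * derivative (hermiteH n) - C (2 * (n : ℝ)) * hermiteH n := by
  have h := derivative_hermiteH_succ n
  rw [hermiteH, map_sub, derivative_mul, derivative_mul] at h
  simp only [map_mul, map_add, map_one, derivative_X, derivative_ofNat, map_ofNat] at h ⊢
  linear_combination -h

theorem degree_hermiteH (n : ℕ) : (hermiteH n).degree = n := by
  induction n with
  | zero => simp [hermiteH]
  | succ n ih =>
    have h1 : (2 * X * hermiteH n).degree = ((n + 1 : ℕ) : WithBot ℕ) := by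
      rw [degree_mul, degree_mul, degree_X, ih, show (2 : ℝ[X]) = C 2 from rfl,
        degree_C two_ne_zero, zero_add, add_comm]
      rfl
    rw [hermiteH, degree_sub_eq_left_of_degree_lt, h1]
    rw [h1]
    refine (degree_derivative_le).trans_lt ?_
    rw [ih]
    exact_mod_cast Nat.lt_succ_self n

/-- The Hermite polynomials as a polynomial sequence. -/
def hermiteSequence : Polynomial.Sequence ℝ := ⟨hermiteH, degree_hermiteH⟩

theorem linearIndependent_hermiteH : LinearIndependent ℝ hermiteH :=
  hermiteSequence.linearIndependent

theorem span_hermiteH : Submodule.span ℝ (Set.range hermiteH) = ⊤ :=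
  hermiteSequence.span fun i => by
    rw [isUnit_iff_ne_zero, Ne, leadingCoeff_eq_zero]
    exact hermiteSequence.ne_zero i

theorem algebraMap_wr {D : Derivation ℝ (FractionRing ℝ[X]) (FractionRing ℝ[X])}
    (hD : ∀ p : ℝ[X], D (algebraMap _ _ p) = algebraMap _ _ (derivative p))
    {n : ℕ} (f : Fin n → ℝ[X]) :
    algebraMap ℝ[X] (FractionRing ℝ[X]) (wr f) = wronskian D fun i => algebraMap _ _ (f i) := by
  have hit : ∀ (i : ℕ) (p : ℝ[X]), algebraMap ℝ[X] (FractionRing ℝ[X]) (derivative^[i] p) =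
      D^[i] (algebraMap _ _ p) := by
    intro i
    induction i with
    | zero => simp
    | succ i ih => intro p; rw [Function.iterate_succ_apply', ← hD, ih,
        Function.iterate_succ_apply']
  rw [wr, wronskian, RingHom.map_det]
  congr 1
  ext i j
  simp [hit]

theorem comp_snoc {α β : Type*} (h : α → β) {n : ℕ} (f : Fin n → α) (a : α) :
    (fun i => h (Fin.snoc (α := fun _ => α) f a i)) =
      Fin.snoc (α := fun _ => β) (fun i => h (f i)) (h a) := by
  ext i
  refine Fin.lastCases ?_ (fun i => ?_) i <;> simp

/-- The case `a = 2x`, `v = 0`, `E = 2n` of `wronskian_bilinear`. -/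
theorem wr_hermiteH_bilinear {n : ℕ} (φ : Fin n → ℕ) (i j : ℕ) (W V U Y : ℝ[X])
    (hW : W = wr fun k => hermiteH (φ k))
    (hV : V = wr (Fin.snoc (α := fun _ => ℝ[X]) (fun k => hermiteH (φ k)) (hermiteH i)))
    (hU : U = wr (Fin.snoc (α := fun _ => ℝ[X]) (fun k => hermiteH (φ k)) (hermiteH j)))
    (hY : Y = wr (Fin.snoc (α := fun _ => ℝ[X])
      (Fin.snoc (α := fun _ => ℝ[X]) (fun k => hermiteH (φ k)) (hermiteH i)) (hermiteH j))) :
    derivative Y * W - Y * derivative W - 2 * X * Y * W = C (2 * (i : ℝ) - 2 * j) * V * U := by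
  obtain ⟨D, hD⟩ := exists_derivation_fractionRing
  have hode : ∀ m : ℕ, D (D (algebraMap ℝ[X] (FractionRing ℝ[X]) (hermiteH m))) =
      algebraMap ℝ[X] (FractionRing ℝ[X]) (2 * X) * D (algebraMap ℝ[X] (FractionRing ℝ[X]) (hermiteH m)) +
        (0 - algebraMap ℝ[X] (FractionRing ℝ[X]) (C (2 * (m : ℝ)))) * algebraMap ℝ[X] (FractionRing ℝ[X]) (hermiteH m) := by
    intro m
    rw [hD, hD, derivative_derivative_hermiteH, map_sub, map_mul,
      map_mul _ (C (2 * (m : ℝ)))]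
    ring
  have hC : ∀ c : ℝ, D (algebraMap ℝ[X] (FractionRing ℝ[X]) (C c)) = 0 := fun c => by rw [hD, derivative_C, map_zero]
  have h := wronskian_bilinear D (algebraMap ℝ[X] (FractionRing ℝ[X]) (2 * X)) 0
    (fun k => algebraMap ℝ[X] (FractionRing ℝ[X]) (hermiteH (φ k))) (fun k => algebraMap ℝ[X] (FractionRing ℝ[X]) (C (2 * (φ k : ℝ))))
    _ _ _ _ (fun _ => hC _) (hC _) (hC _) (fun _ => hode _) (hode i) (hode j)
  apply IsFractionRing.injective ℝ[X] (FractionRing ℝ[X])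
  rw [hW, hV, hU, hY]
  simp only [map_sub, map_mul, ← hD]
  simp only [algebraMap_wr hD, comp_snoc]
  simp only [map_mul] at h ⊢
  exact h

theorem wr_one_cons {n : ℕ} (f : Fin n → ℝ[X]) :
    wr (Fin.cons 1 f : Fin (n + 1) → ℝ[X]) = wr fun i => derivative (f i) := by
  obtain ⟨D, hD⟩ := exists_derivation_fractionRing
  apply IsFractionRing.injective ℝ[X] (FractionRing ℝ[X])
  rw [algebraMap_wr hD, algebraMap_wr hD]
  have h1 : (fun i => algebraMap ℝ[X] (FractionRing ℝ[X])
      ((Fin.cons 1 f : Fin (n + 1) → ℝ[X]) i)) =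
      (Fin.cons 1 fun i => algebraMap _ _ (f i) : Fin (n + 1) → FractionRing ℝ[X]) := by
    ext i
    refine Fin.cases ?_ (fun i => ?_) i <;> simp
  rw [h1, wronskian_cons D (s := 0) (by simp), one_mul]
  simp [hD]

theorem wr_mul_C {n : ℕ} (c : Fin n → ℝ) (f : Fin n → ℝ[X]) :
    (wr fun i => C (c i) * f i) = C (∏ i, c i) * wr f := by
  rw [wr, wr, map_prod, ← Matrix.det_mul_row]
  congr 1
  ext1 i j
  simp [iterate_derivative_C_mul]

/-! ### The differential operator `f ↦ Wr[φ, f]`: image and kernel. -/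

/-- Expansion along the last column: a linear differential operator of order `n` with leading
coefficient `wr φ`. -/
theorem exists_wr_snoc_eq_sum {n : ℕ} (φ : Fin n → ℝ[X]) :
    ∃ c : ℕ → ℝ[X], c n = wr φ ∧ ∀ f, wr (Fin.snoc (α := fun _ => ℝ[X]) φ f) =
      ∑ i ∈ Finset.range (n + 1), c i * derivative^[i] f := by
  let c : Fin (n + 1) → ℝ[X] := fun i => (-1) ^ ((i : ℕ) + n) *
    (Matrix.of fun (k : Fin n) (j : Fin n) => derivative^[(i.succAbove k : ℕ)] (φ j)).det
  refine ⟨fun i => if h : i < n + 1 then c ⟨i, h⟩ else 0, ?_, fun f => ?_⟩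
  · simp only [lt_add_iff_pos_right, zero_lt_one, dite_true, c]
    rw [show (⟨n, by omega⟩ : Fin (n + 1)) = Fin.last n from rfl]
    simp [wr, ← two_mul]
  · rw [Finset.sum_range, wr, Matrix.det_succ_column _ (Fin.last n)]
    refine Finset.sum_congr rfl fun i _ => ?_
    simp only [Fin.is_lt, dite_true, c, Matrix.of_apply, Fin.snoc_last, Fin.val_last]
    rw [mul_right_comm]
    congr 3
    ext1 k j
    simp

theorem exists_derivative_eq (p : ℝ[X]) : ∃ q : ℝ[X], derivative q = p := by
  induction p using Polynomial.induction_on' with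
  | add p q hp hq =>
    obtain ⟨a, rfl⟩ := hp
    obtain ⟨b, rfl⟩ := hq
    exact ⟨a + b, by simp⟩
  | monomial n a =>
    refine ⟨monomial (n + 1) (a / (n + 1)), ?_⟩
    rw [derivative_monomial]
    congr 1
    push_cast
    field_simp

theorem wr_snoc_self {n : ℕ} (φ : Fin n → ℝ[X]) (k : Fin n) :
    wr (Fin.snoc (α := fun _ => ℝ[X]) φ (φ k)) = 0 := by
  refine Matrix.det_zero_of_column_eq (i := k.castSucc) (j := Fin.last n)
    (Fin.castSucc_lt_last k).ne fun i => ?_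
  simp

/-- Variation of parameters: multiples of the square of the Wronskian are in the image. -/
theorem exists_wr_snoc_eq {n : ℕ} (φ : Fin n → ℝ[X]) (p : ℝ[X]) :
    ∃ f, wr (Fin.snoc (α := fun _ => ℝ[X]) φ f) = wr φ ^ 2 * p := by
  rcases n with _ | n
  · refine ⟨p, ?_⟩
    simp [wr, Matrix.det_unique, Fin.snoc]
  let M : Matrix (Fin (n + 1)) (Fin (n + 1)) ℝ[X] :=
    Matrix.of fun i j => derivative^[(i : ℕ)] (φ j)
  -- Cramer's rule without the division by `wr φ`: the `u k` stay polynomial, at the price of one of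
  -- the two factors `wr φ`. The other is the leading coefficient of the operator.
  choose u hu using fun k => exists_derivative_eq (M.adjugate k (Fin.last n) * p)
  have hadj : ∀ i : ℕ, i < n + 1 → ∑ k, derivative (u k) * derivative^[i] (φ k) =
      if i = n then wr φ * p else 0 := by
    intro i hi
    have h := congrFun (congrFun (Matrix.mul_adjugate M) ⟨i, hi⟩) (Fin.last n)
    rw [Matrix.mul_apply] at h
    have h2 : ∑ k, derivative (u k) * derivative^[i] (φ k) =
        (∑ k, M ⟨i, hi⟩ k * M.adjugate k (Fin.last n)) * p := by
      rw [Finset.sum_mul]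
      refine Finset.sum_congr rfl fun k _ => ?_
      rw [hu]
      simp only [M, Matrix.of_apply]
      ring
    rw [h2, h]
    simp only [Matrix.smul_apply, Matrix.one_apply, Fin.ext_iff, Fin.val_last, smul_eq_mul]
    split_ifs
    · rw [mul_one]; rfl
    · simp
  have hlow : ∀ i : ℕ, i < n + 1 →
      derivative^[i] (∑ k, u k * φ k) = ∑ k, u k * derivative^[i] (φ k) := by
    intro i
    induction i with
    | zero => intro _; rfl
    | succ i ih =>
      intro hi
      rw [Function.iterate_succ_apply', ih (by omega)]
      simp only [derivative_sum, derivative_mul, Finset.sum_add_distrib]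
      rw [hadj i (by omega), if_neg (by omega), zero_add]
      simp only [Function.iterate_succ_apply']
  have htop : derivative^[n + 1] (∑ k, u k * φ k) =
      ∑ k, u k * derivative^[n + 1] (φ k) + wr φ * p := by
    rw [Function.iterate_succ_apply', hlow n (by omega)]
    simp only [derivative_sum, derivative_mul, Finset.sum_add_distrib]
    rw [hadj n (by omega), if_pos rfl, add_comm]
    simp only [Function.iterate_succ_apply']
  obtain ⟨c, hc, hwr⟩ := exists_wr_snoc_eq_sum φ
  refine ⟨∑ k, u k * φ k, ?_⟩
  have hker : ∀ k, ∑ i ∈ Finset.range (n + 1 + 1), c i * derivative^[i] (φ k) = 0 := fun k => by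
    rw [← hwr, wr_snoc_self]
  have : ∑ i ∈ Finset.range (n + 1 + 1), c i * ∑ k, u k * derivative^[i] (φ k) = 0 := by
    simp only [Finset.mul_sum]
    rw [Finset.sum_comm]
    refine Finset.sum_eq_zero fun k _ => ?_
    rw [← mul_zero (u k), ← hker k, Finset.mul_sum]
    exact Finset.sum_congr rfl fun i _ => by ring
  rw [hwr, Finset.sum_range_succ, htop, Finset.sum_congr rfl fun i hi => by
    rw [hlow i (Finset.mem_range.1 hi)], ← hc]
  rw [Finset.sum_range_succ] at this
  linear_combination this

theorem pow_X_sub_C_dvd_of_iterate_derivative {p : ℝ[X]} {a : ℝ} {n : ℕ}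
    (h : ∀ i < n, (derivative^[i] p).eval a = 0) : (X - C a) ^ n ∣ p := by
  by_cases hp : p = 0
  · simp [hp]
  rcases n with _ | n
  · simp
  rw [← le_rootMultiplicity_iff hp, Nat.succ_le_iff, lt_rootMultiplicity_iff_isRoot_iterate_derivative hp]
  exact fun m hm => h m (by omega)

/-- Uniqueness for the equation `Wr[φ, g] = 0` at a point where its leading coefficient is nonzero:
a solution vanishing there to order `n` vanishes to every order. -/
theorem wr_snoc_ne_zero {n : ℕ} (φ : Fin n → ℝ[X]) {a : ℝ} (ha : (wr φ).eval a ≠ 0) {f : ℝ[X]}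
    (hf : f ∉ Submodule.span ℝ (Set.range φ)) : wr (Fin.snoc (α := fun _ => ℝ[X]) φ f) ≠ 0 := by
  intro h0
  let M : Matrix (Fin n) (Fin n) ℝ := Matrix.of fun i j => (derivative^[(i : ℕ)] (φ j)).eval a
  have hM : IsUnit M := by
    rw [Matrix.isUnit_iff_isUnit_det, isUnit_iff_ne_zero]
    rw [wr, ← coe_evalRingHom, RingHom.map_det] at ha
    convert ha using 2
    ext1 i j
    simp [M]
  obtain ⟨c, hc⟩ := (Matrix.mulVec_surjective_iff_isUnit.2 hM)
    (fun i => (derivative^[(i : ℕ)] f).eval a)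
  -- `c` matches the first `n` derivatives of `f` at `a`.
  set g := f - ∑ k, c k • φ k with hg
  have hmem : ∑ k, c k • φ k ∈ Submodule.span ℝ (Set.range φ) :=
    Submodule.sum_mem _ fun k _ => Submodule.smul_mem _ _ (Submodule.subset_span ⟨k, rfl⟩)
  have hg0 : g ≠ 0 := fun h => hf (by rw [sub_eq_zero.1 h]; exact hmem)
  obtain ⟨d, hd, hwr⟩ := exists_wr_snoc_eq_sum φ
  have hwg : wr (Fin.snoc (α := fun _ => ℝ[X]) φ g) = 0 := by
    have hk : ∀ k, ∑ i ∈ Finset.range (n + 1), d i * derivative^[i] (φ k) = 0 := fun k => by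
      rw [← hwr, wr_snoc_self]
    have : ∑ i ∈ Finset.range (n + 1), d i * derivative^[i] (∑ k, c k • φ k) =
        ∑ k, c k • ∑ i ∈ Finset.range (n + 1), d i * derivative^[i] (φ k) := by
      simp only [iterate_derivative_sum, iterate_derivative_smul, Finset.mul_sum, Finset.smul_sum]
      rw [Finset.sum_comm]
      simp only [mul_smul_comm]
    rw [hwr] at h0 ⊢
    simp only [hg, iterate_derivative_sub, mul_sub, Finset.sum_sub_distrib]
    rw [h0, this]
    simp [hk]
  have hdvd : (X - C a) ^ n ∣ g := pow_X_sub_C_dvd_of_iterate_derivative fun i hi => by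
    have := congrFun hc ⟨i, hi⟩
    simp only [Matrix.mulVec, dotProduct, M, Matrix.of_apply] at this
    simp only [hg, iterate_derivative_sub, iterate_derivative_sum, iterate_derivative_smul,
      eval_sub, eval_finsetSum, eval_smul, smul_eq_mul]
    rw [← this, sub_eq_zero]
    exact Finset.sum_congr rfl fun k _ => mul_comm _ _
  have hall : ∀ m, (X - C a) ^ (n + m) ∣ g := by
    intro m
    induction m with
    | zero => exact hdvd
    | succ m ih =>
      have hlow : ∀ i < n, (X - C a) ^ (m + 1) ∣ derivative^[i] g := fun i hi =>
        (pow_dvd_pow _ (by omega)).trans (pow_sub_dvd_iterate_derivative_of_pow_dvd i ih)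
      rw [hwr, Finset.sum_range_succ, hd] at hwg
      have h1 : (X - C a) ^ (m + 1) ∣ wr φ * derivative^[n] g := by
        rw [(eq_neg_of_add_eq_zero_right hwg : wr φ * derivative^[n] g = _), dvd_neg]
        exact Finset.dvd_sum fun i hi =>
          Dvd.dvd.mul_left (hlow i (Finset.mem_range.1 hi)) _
      have h2 : IsCoprime ((X - C a) ^ (m + 1)) (wr φ) := by
        refine IsCoprime.pow_left ?_
        refine ((irreducible_X_sub_C a).coprime_iff_not_dvd).2 ?_
        rwa [dvd_iff_isRoot]
      have h3 := h2.dvd_of_dvd_mul_left h1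
      refine pow_X_sub_C_dvd_of_iterate_derivative fun i hi => ?_
      rcases lt_or_ge i n with hin | hin
      · obtain ⟨q, hq⟩ := hlow i hin
        simp [hq]
      · obtain ⟨t, rfl⟩ := Nat.exists_eq_add_of_le hin
        rw [add_comm, Function.iterate_add_apply]
        obtain ⟨q, hq⟩ := (dvd_pow_self (X - C a) (by omega : m + 1 - t ≠ 0)).trans
          (pow_sub_dvd_iterate_derivative_of_pow_dvd t h3)
        simp [hq]
  have h1 := (pow_dvd_pow _ (by omega : g.natDegree + 1 ≤ n + (g.natDegree + 1))).trans
    (hall (g.natDegree + 1))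
  have h2 := natDegree_le_of_dvd h1 hg0
  rw [natDegree_pow, natDegree_X_sub_C] at h2
  omega

/-! ### Gaussian integrability and determinacy by moments. -/

theorem integrable_exp_mul_abs_mul_exp (t : ℝ) :
    Integrable fun x : ℝ => Real.exp (t * |x|) * Real.exp (-x ^ 2) := by
  -- From `t|x| ≤ t²/2 + x²/2`.
  refine ((integrable_exp_neg_mul_sq (by norm_num : (0 : ℝ) < 1 / 2)).const_mul
    (Real.exp (t ^ 2 / 2))).mono' (by fun_prop) (ae_of_all _ fun x => ?_)
  rw [← Real.exp_add, ← Real.exp_add, Real.norm_of_nonneg (Real.exp_pos _).le, Real.exp_le_exp]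
  nlinarith [sq_nonneg (t - |x|), sq_abs x]

theorem exists_abs_eval_le (p : ℝ[X]) : ∃ B, ∀ x : ℝ, |p.eval x| ≤ B * Real.exp |x| := by
  induction p using Polynomial.induction_on' with
  | add p q hp hq =>
    obtain ⟨a, ha⟩ := hp
    obtain ⟨b, hb⟩ := hq
    refine ⟨a + b, fun x => ?_⟩
    rw [eval_add, add_mul]
    exact (abs_add_le _ _).trans (add_le_add (ha x) (hb x))
  | monomial n a =>
    refine ⟨|a| * n.factorial, fun x => ?_⟩
    rw [eval_monomial, abs_mul, abs_pow, mul_assoc]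
    refine mul_le_mul_of_nonneg_left ?_ (abs_nonneg a)
    have := Real.pow_div_factorial_le_exp |x| (abs_nonneg x) n
    rwa [div_le_iff₀' (by positivity)] at this

theorem integrable_eval_mul_exp (p : ℝ[X]) (t : ℝ) :
    Integrable fun x : ℝ => p.eval x * Real.exp (t * |x|) * Real.exp (-x ^ 2) := by
  obtain ⟨B, hB⟩ := exists_abs_eval_le p
  refine ((integrable_exp_mul_abs_mul_exp (t + 1)).const_mul B).mono'
    (by have := p.continuous; fun_prop) (ae_of_all _ fun x => ?_)
  rw [norm_mul, norm_mul, Real.norm_of_nonneg (Real.exp_pos _).le,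
    Real.norm_of_nonneg (Real.exp_pos _).le, ← mul_assoc, add_mul, one_mul, Real.exp_add]
  refine mul_le_mul_of_nonneg_right ?_ (Real.exp_pos _).le
  rw [mul_left_comm, mul_comm]
  exact mul_le_mul_of_nonneg_left (hB x) (Real.exp_pos _).le

theorem integrable_eval_mul_exp_neg_sq (p : ℝ[X]) :
    Integrable fun x : ℝ => p.eval x * Real.exp (-x ^ 2) := by
  simpa using integrable_eval_mul_exp p 0

/-- The positive and negative parts of `g` are densities of finite measures with the same
characteristic function. -/
theorem ae_eq_zero_of_forall_integral_cexp_eq_zero {g : ℝ → ℝ} (hg : Integrable g)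
    (h : ∀ t : ℝ, ∫ x : ℝ, Complex.exp (t * x * Complex.I) * g x = 0) : g =ᵐ[volume] 0 := by
  obtain ⟨k, hkm, hk⟩ : ∃ k : ℝ → ℝ, Measurable k ∧ g =ᵐ[volume] k :=
    ⟨hg.1.mk g, hg.1.stronglyMeasurable_mk.measurable, hg.1.ae_eq_mk⟩
  refine hk.trans ?_
  have hki : Integrable k := hg.congr hk
  have h : ∀ t : ℝ, ∫ x : ℝ, Complex.exp (t * x * Complex.I) * k x = 0 := fun t => by
    rw [← h t]
    refine integral_congr_ae ?_
    filter_upwards [hk] with x hx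
    rw [hx]
  have hfin : ∀ k : ℝ → ℝ, Integrable k → ∫⁻ x, ENNReal.ofReal (k x) ≠ ⊤ := fun k hki =>
    ((lintegral_mono fun x => Real.ofReal_le_enorm (k x)).trans_lt hki.2).ne
  have : IsFiniteMeasure (volume.withDensity fun x => ENNReal.ofReal (k x)) :=
    isFiniteMeasure_withDensity (hfin k hki)
  have : IsFiniteMeasure (volume.withDensity fun x => ENNReal.ofReal (-k x)) :=
    isFiniteMeasure_withDensity (hfin _ hki.neg)
  have hcf : ∀ (k : ℝ → ℝ) (_ : Measurable k) (t : ℝ),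
      charFun (volume.withDensity fun x => ENNReal.ofReal (k x)) t =
        ∫ x : ℝ, Complex.exp (t * x * Complex.I) * ((max (k x) 0 : ℝ) : ℂ) := by
    intro k hkm t
    rw [charFun_apply_real]
    refine (integral_withDensity_eq_integral_smul (f := fun x => (k x).toNNReal)
      (hkm.real_toNNReal) _).trans ?_
    refine integral_congr_ae (ae_of_all _ fun x => ?_)
    simp only [NNReal.smul_def, Real.coe_toNNReal', Complex.real_smul]
    ring
  have hint : ∀ (k : ℝ → ℝ) (_ : Integrable k) (t : ℝ),
      Integrable fun x : ℝ => Complex.exp (t * x * Complex.I) * ((max (k x) 0 : ℝ) : ℂ) := by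
    intro k hk t
    refine (hk.pos_part.ofReal (𝕜 := ℂ)).bdd_mul (c := 1) (by fun_prop) (ae_of_all _ fun x => ?_)
    rw [← Complex.ofReal_mul, Complex.norm_exp_ofReal_mul_I]
  have hμ : (volume.withDensity fun x => ENNReal.ofReal (k x)) =
      volume.withDensity fun x => ENNReal.ofReal (-k x) := by
    refine Measure.ext_of_charFun (funext fun t => ?_)
    rw [hcf k hkm, hcf (fun x => -k x) hkm.neg, ← sub_eq_zero,
      ← integral_sub (hint k hki t) (hint (fun x => -k x) hki.neg t), ← h t]
    refine integral_congr_ae (ae_of_all _ fun x => ?_)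
    simp only
    rw [← mul_sub, ← Complex.ofReal_sub]
    congr 2
    rcases le_total 0 (k x) with h | h
    · simp [h]
    · simp [h]
  rw [withDensity_eq_iff (by fun_prop) (by fun_prop) (hfin k hki)] at hμ
  filter_upwards [hμ] with x hx
  rcases lt_trichotomy (k x) 0 with h | h | h
  · rw [ENNReal.ofReal_of_nonpos h.le, eq_comm, ENNReal.ofReal_eq_zero] at hx
    linarith
  · exact h
  · rw [ENNReal.ofReal_of_nonpos (neg_nonpos.2 h.le), ENNReal.ofReal_eq_zero] at hx
    linarith

/-- Exponential moments allow `e^{itx}` to be expanded under the integral, so the Fourier transform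
of `g` vanishes. -/
theorem ae_eq_zero_of_forall_moment_eq_zero {g : ℝ → ℝ}
    (hg : ∀ t : ℝ, Integrable fun x => g x * Real.exp (t * |x|))
    (h : ∀ n : ℕ, ∫ x, g x * x ^ n = 0) : g =ᵐ[volume] 0 := by
  have hg0 : Integrable g := by simpa using hg 0
  refine ae_eq_zero_of_forall_integral_cexp_eq_zero hg0 fun t => ?_
  have hs : ∀ x : ℝ, HasSum (fun n : ℕ => (|t| * |x|) ^ n / n.factorial * |g x|)
      (Real.exp (|t| * |x|) * |g x|) := fun x => by
    have := (NormedSpace.expSeries_div_hasSum_exp (|t| * |x|)).mul_right |g x|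
    rwa [← Real.exp_eq_exp_ℝ] at this
  have key := hasSum_integral_of_dominated_convergence (μ := volume)
    (F := fun (n : ℕ) (x : ℝ) => ((t * x * Complex.I) ^ n / n.factorial * g x : ℂ))
    (f := fun x => Complex.exp (t * x * Complex.I) * g x)
    (fun n x => (|t| * |x|) ^ n / n.factorial * |g x|)
    (fun n => by
      have := hg0.1
      exact (Continuous.aestronglyMeasurable (by fun_prop)).mul
        (Complex.continuous_ofReal.comp_aestronglyMeasurable this))
    (fun n => ae_of_all _ fun x => by simp)
    (ae_of_all _ fun x => (hs x).summable)
    (by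
      simp only [fun x => (hs x).tsum_eq]
      refine (hg |t|).norm.congr (ae_of_all _ fun x => ?_)
      simp [mul_comm])
    (ae_of_all _ fun x => by
      have := (NormedSpace.expSeries_div_hasSum_exp ((t : ℂ) * x * Complex.I)).mul_right (g x : ℂ)
      rwa [← Complex.exp_eq_exp_ℂ] at this)
  have hz : ∀ n : ℕ, ∫ x : ℝ, ((t * x * Complex.I) ^ n / n.factorial * g x : ℂ) = 0 := by
    intro n
    have : (fun x : ℝ => ((t * x * Complex.I) ^ n / n.factorial * g x : ℂ)) =
        fun x : ℝ => ((t * Complex.I) ^ n / n.factorial : ℂ) * ((g x * x ^ n : ℝ) : ℂ) := by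
      ext x
      push_cast
      ring
    rw [this, integral_const_mul, integral_complex_ofReal, h n]
    simp
  simp only [hz] at key
  exact key.unique hasSum_zero

/-! ### The weighted space and criteria for complete orthogonal bases. -/

/-- The Gaussian measure divided by the square of the polynomial `q`. -/
def rationalWeight (q : ℝ[X]) : Measure ℝ :=
  volume.withDensity fun x => ENNReal.ofReal (Real.exp (-x ^ 2) / q.eval x ^ 2)

theorem measurable_rationalWeight (q : ℝ[X]) :
    Measurable fun x : ℝ => Real.exp (-x ^ 2) / q.eval x ^ 2 := by
  have := q.continuous.measurable
  fun_prop

theorem integrable_rationalWeight_iff (q : ℝ[X]) {f : ℝ → ℝ} :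
    Integrable f (rationalWeight q) ↔
      Integrable fun x => Real.exp (-x ^ 2) / q.eval x ^ 2 * f x := by
  refine (integrable_withDensity_iff_integrable_smul
    (f := fun x : ℝ => (Real.exp (-x ^ 2) / q.eval x ^ 2).toNNReal)
    (measurable_rationalWeight q).real_toNNReal).trans (integrable_congr (ae_of_all _ fun x => ?_))
  simp only [NNReal.smul_def, smul_eq_mul]
  rw [Real.coe_toNNReal _ (by positivity)]

theorem integral_rationalWeight (q : ℝ[X]) (f : ℝ → ℝ) :
    ∫ x, f x ∂rationalWeight q = ∫ x, Real.exp (-x ^ 2) / q.eval x ^ 2 * f x := by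
  refine (integral_withDensity_eq_integral_smul
    (f := fun x : ℝ => (Real.exp (-x ^ 2) / q.eval x ^ 2).toNNReal)
    (measurable_rationalWeight q).real_toNNReal _).trans
      (integral_congr_ae (ae_of_all _ fun x => ?_))
  simp only [NNReal.smul_def, smul_eq_mul]
  rw [Real.coe_toNNReal _ (by positivity)]

theorem ae_rationalWeight_iff {q : ℝ[X]} (hq : ∀ x, q.eval x ≠ 0) {p : ℝ → Prop} :
    (∀ᵐ x ∂rationalWeight q, p x) ↔ ∀ᵐ x, p x := by
  rw [rationalWeight, ae_withDensity_iff (measurable_rationalWeight q).ennreal_ofReal]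
  have : ∀ x, ENNReal.ofReal (Real.exp (-x ^ 2) / q.eval x ^ 2) ≠ 0 := fun x => by
    have := hq x
    rw [Ne, ENNReal.ofReal_eq_zero, not_le]
    positivity
  simp [this]

theorem memLp_eval_mul_exp {q : ℝ[X]} (hq : ∀ x, q.eval x ≠ 0) (p : ℝ[X]) (t : ℝ) :
    MemLp (fun x : ℝ => p.eval x * Real.exp (t * |x|)) 2 (rationalWeight q) := by
  have hc : Continuous fun x : ℝ => p.eval x * Real.exp (t * |x|) := by
    have := p.continuous
    fun_prop
  rw [memLp_two_iff_integrable_sq hc.aestronglyMeasurable, integrable_rationalWeight_iff]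
  -- `|q|` attains its minimum, which is positive, so `1 / q²` is bounded.
  obtain ⟨a, ha⟩ := exists_forall_norm_le q
  have ha0 : 0 < |q.eval a| := abs_pos.2 (hq a)
  refine ((integrable_eval_mul_exp (p ^ 2) (2 * t)).const_mul (|q.eval a| ^ 2)⁻¹).mono' ?_
    (ae_of_all _ fun x => ?_)
  · exact (measurable_rationalWeight q).aestronglyMeasurable.mul
      (hc.pow 2).aestronglyMeasurable
  · rw [Real.norm_of_nonneg (by positivity), eval_pow, mul_pow, ← Real.exp_nat_mul,
      div_eq_mul_inv]
    have h1 : (q.eval x ^ 2)⁻¹ ≤ (|q.eval a| ^ 2)⁻¹ := by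
      refine inv_anti₀ (by positivity) ?_
      rw [← sq_abs (q.eval x)]
      exact pow_le_pow_left₀ (abs_nonneg _) (ha x) 2
    push_cast
    rw [← mul_assoc 2 t]
    calc _ = (q.eval x ^ 2)⁻¹ * (p.eval x ^ 2 * Real.exp (2 * t * |x|) * Real.exp (-x ^ 2)) := by
          ring
      _ ≤ _ := mul_le_mul_of_nonneg_right h1 (by positivity)

theorem memLp_eval {q : ℝ[X]} (hq : ∀ x, q.eval x ≠ 0) (p : ℝ[X]) :
    MemLp (fun x : ℝ => p.eval x) 2 (rationalWeight q) := by
  simpa using memLp_eval_mul_exp hq p 0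

/-- Testing against multiples of `q²` suffices: this factor cancels the denominator and leaves the
moments of `f e^{-x²}`. -/
theorem ae_eq_zero_of_forall_integral_eq_zero {q : ℝ[X]} (hq : ∀ x, q.eval x ≠ 0) {f : ℝ → ℝ}
    (hf : MemLp f 2 (rationalWeight q))
    (h : ∀ p : ℝ[X], ∫ x, f x * (q ^ 2 * p).eval x ∂rationalWeight q = 0) :
    f =ᵐ[rationalWeight q] 0 := by
  have hw : ∀ (x : ℝ) (c : ℝ), Real.exp (-x ^ 2) / q.eval x ^ 2 * (f x * (q.eval x ^ 2 * c)) =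
      f x * Real.exp (-x ^ 2) * c := fun x c => by
    have := hq x
    field_simp
  have h0 : (fun x => f x * Real.exp (-x ^ 2)) =ᵐ[volume] 0 := by
    refine ae_eq_zero_of_forall_moment_eq_zero (fun t => ?_) fun n => ?_
    · have := hf.integrable_mul (memLp_eval_mul_exp hq (q ^ 2) t)
      rw [integrable_rationalWeight_iff] at this
      refine this.congr (ae_of_all _ fun x => ?_)
      simp only [Pi.mul_apply, eval_pow]
      exact hw x _
    · rw [← h (X ^ n), integral_rationalWeight]
      refine integral_congr_ae (ae_of_all _ fun x => ?_)
      simp only [eval_mul, eval_pow, eval_X]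
      exact (hw x _).symm
  refine (ae_rationalWeight_iff hq).2 ?_
  filter_upwards [h0] with x hx
  exact (mul_eq_zero.1 hx).resolve_right (Real.exp_pos _).ne'

theorem isCompleteOrthogonalBasis_of_total {m : Measure ℝ} {ι : Type} (P : ι → ℝ[X])
    (hmem : ∀ i, MemLp (fun x => (P i).eval x) 2 m)
    (horth : ∀ i j, i ≠ j → ∫ x, (P i).eval x * (P j).eval x ∂m = 0)
    (hpos : ∀ i, 0 < ∫ x, (P i).eval x * (P i).eval x ∂m)
    (htot : ∀ f : ℝ → ℝ, MemLp f 2 m → (∀ i, ∫ x, f x * (P i).eval x ∂m = 0) → f =ᵐ[m] 0) :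
    IsCompleteOrthogonalBasis m P := by
  let c : ι → ℝ := fun i => (√(∫ x, (P i).eval x * (P i).eval x ∂m))⁻¹
  have hc : ∀ i, 0 < c i := fun i => inv_pos.2 (Real.sqrt_pos.2 (hpos i))
  let v : ι → Lp ℝ 2 m := fun i => c i • (hmem i).toLp _
  have hv : ∀ i, (v i : ℝ → ℝ) =ᵐ[m] fun x => c i * (P i).eval x := fun i => by
    filter_upwards [Lp.coeFn_smul (c i) ((hmem i).toLp _), (hmem i).coeFn_toLp] with x h1 h2
    rw [h1, Pi.smul_apply, h2, smul_eq_mul]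
  have hin : ∀ (i : ι) (f : Lp ℝ 2 m), inner ℝ (v i) f = c i * ∫ x, f x * (P i).eval x ∂m := by
    intro i f
    rw [L2.inner_def, ← integral_const_mul]
    refine integral_congr_ae ?_
    filter_upwards [hv i] with x hx
    rw [hx, real_inner_eq_re_inner, RCLike.re_to_real]
    simp
    ring
  have hvv : ∀ i j, inner ℝ (v i) (v j) =
      c i * (c j * ∫ x, (P i).eval x * (P j).eval x ∂m) := fun i j => by
    rw [hin, ← integral_const_mul (c j)]
    congr 1
    refine integral_congr_ae ?_
    filter_upwards [hv j] with x hx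
    rw [hx]
    ring
  have hon : Orthonormal ℝ v := by
    classical
    rw [orthonormal_iff_ite]
    intro i j
    rw [hvv]
    split_ifs with hij
    · subst hij
      have := Real.mul_self_sqrt (hpos i).le
      simp only [c]
      rw [← mul_assoc, ← mul_inv, this]
      exact inv_mul_cancel₀ (hpos i).ne'
    · rw [horth i j hij, mul_zero, mul_zero]
  have hbot : (Submodule.span ℝ (Set.range v))ᗮ = ⊥ := by
    rw [Submodule.eq_bot_iff]
    intro f hf
    refine (Lp.eq_zero_iff_ae_eq_zero).2 (htot f (Lp.memLp f) fun i => ?_)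
    have h1 := (Submodule.mem_orthogonal _ f).1 hf (v i) (Submodule.subset_span ⟨i, rfl⟩)
    rw [hin] at h1
    exact (mul_eq_zero.1 h1).resolve_left (hc i).ne'
  refine ⟨HilbertBasis.mkOfOrthogonalEqBot hon hbot, fun i => ⟨c i, hc i, ?_⟩⟩
  rw [HilbertBasis.coe_mkOfOrthogonalEqBot]
  exact hv i

theorem exists_polynomial_of_mem_span {m : Measure ℝ} {ι : Type} {b : ι → Lp ℝ 2 m}
    {S : Submodule ℝ ℝ[X]} (hb : ∀ i, ∃ p ∈ S, ∀ᵐ x ∂m, b i x = p.eval x) {f : Lp ℝ 2 m}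
    (hf : f ∈ Submodule.span ℝ (Set.range b)) : ∃ p ∈ S, ∀ᵐ x ∂m, f x = p.eval x := by
  induction hf using Submodule.span_induction with
  | mem f hf =>
    obtain ⟨i, rfl⟩ := hf
    exact hb i
  | zero =>
    refine ⟨0, S.zero_mem, ?_⟩
    filter_upwards [Lp.coeFn_zero ℝ 2 m] with x hx
    rw [hx, eval_zero, Pi.zero_apply]
  | add f g _ _ hf hg =>
    obtain ⟨p, hp, hfp⟩ := hf
    obtain ⟨q, hq, hgq⟩ := hg
    refine ⟨p + q, S.add_mem hp hq, ?_⟩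
    filter_upwards [hfp, hgq, Lp.coeFn_add f g] with x h1 h2 h3
    rw [h3, Pi.add_apply, h1, h2, eval_add]
  | smul c f _ hf =>
    obtain ⟨p, hp, hfp⟩ := hf
    refine ⟨c • p, S.smul_mem c hp, ?_⟩
    filter_upwards [hfp, Lp.coeFn_smul c f] with x h1 h2
    rw [h2, Pi.smul_apply, h1, eval_smul]

theorem IsCompleteOrthogonalBasis.dense {m : Measure ℝ} {ι : Type} {P : ι → ℝ[X]}
    (h : IsCompleteOrthogonalBasis m P) {S : Submodule ℝ ℝ[X]} (hS : ∀ i, P i ∈ S) :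
    Dense {f : Lp ℝ 2 m | ∃ p ∈ S, ∀ᵐ x ∂m, f x = p.eval x} := by
  obtain ⟨b, hb⟩ := h
  have hd : Dense (Submodule.span ℝ (Set.range b) : Set (Lp ℝ 2 m)) := by
    rw [Submodule.dense_iff_topologicalClosure_eq_top]
    exact b.dense_span
  refine hd.mono fun f hf => exists_polynomial_of_mem_span (fun i => ?_) hf
  obtain ⟨c, -, hc⟩ := hb i
  refine ⟨c • P i, S.smul_mem c (hS i), ?_⟩
  filter_upwards [hc] with x hx
  rw [hx, eval_smul, smul_eq_mul]

/-! ### Orthogonality and completeness when the Wronskian has no real zeros. -/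

theorem integral_wr_mul_wr_eq_zero {n : ℕ} (φ : Fin n → ℕ)
    (h0 : ∀ x, (wr fun k => hermiteH (φ k)).eval x ≠ 0) {i j : ℕ} (hij : i ≠ j) :
    ∫ x, (wr (Fin.snoc (α := fun _ => ℝ[X]) (fun k => hermiteH (φ k)) (hermiteH i))).eval x *
      (wr (Fin.snoc (α := fun _ => ℝ[X]) (fun k => hermiteH (φ k)) (hermiteH j))).eval x
        ∂rationalWeight (wr fun k => hermiteH (φ k)) = 0 := by
  have key := wr_hermiteH_bilinear φ i j _ _ _ _ rfl rfl rfl rfl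
  revert h0 key
  generalize wr (fun k => hermiteH (φ k)) = W
  generalize wr (Fin.snoc (α := fun _ => ℝ[X]) (Fin.snoc (α := fun _ => ℝ[X])
    (fun k => hermiteH (φ k)) (hermiteH i)) (hermiteH j)) = Y
  generalize wr (Fin.snoc (α := fun _ => ℝ[X]) (fun k => hermiteH (φ k)) (hermiteH i)) = V
  generalize wr (Fin.snoc (α := fun _ => ℝ[X]) (fun k => hermiteH (φ k)) (hermiteH j)) = U
  intro h0 key
  have hint : ∀ p : ℝ[X], Integrable fun x => Real.exp (-x ^ 2) / W.eval x ^ 2 * p.eval x :=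
    fun p => by
      have := (memLp_eval h0 p).integrable_mul (memLp_eval h0 1)
      rw [integrable_rationalWeight_iff] at this
      simpa using this
  have hE : (2 * (i : ℝ) - 2 * j) ≠ 0 := by
    rw [← mul_sub]
    exact mul_ne_zero two_ne_zero (sub_ne_zero.2 (by exact_mod_cast hij))
  rw [integral_rationalWeight]
  refine (mul_eq_zero.1 ?_).resolve_left hE
  rw [← integral_const_mul]
  -- The bilinear identity says that the integrand is the derivative of `Y / W · e^{-x²}`; both are
  -- integrable.
  refine integral_eq_zero_of_hasDerivAt_of_integrable
    (f := fun x => Y.eval x / W.eval x * Real.exp (-x ^ 2)) (fun x => ?_) ?_ ?_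
  · have hx := h0 x
    have hk := congrArg (eval x) key
    simp only [eval_sub, eval_mul, eval_C, eval_X, eval_ofNat] at hk
    have h1 : HasDerivAt (fun x : ℝ => Real.exp (-x ^ 2)) (Real.exp (-x ^ 2) * (-(2 * x))) x := by
      simpa using ((hasDerivAt_pow 2 x).neg).exp
    refine (((Y.hasDerivAt x).div (W.hasDerivAt x) hx).mul h1).congr_deriv ?_
    simp only [Pi.div_apply]
    field_simp
    linear_combination hk
  · simpa only [eval_mul] using (hint (V * U)).const_mul (2 * (i : ℝ) - 2 * j)
  · refine (hint (Y * W)).congr (ae_of_all _ fun x => ?_)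
    have hx := h0 x
    simp only [eval_mul]
    field_simp

theorem integral_eval_mul_self_pos {q : ℝ[X]} (hq : ∀ x, q.eval x ≠ 0) {p : ℝ[X]} (hp : p ≠ 0) :
    0 < ∫ x, p.eval x * p.eval x ∂rationalWeight q := by
  refine lt_of_le_of_ne (integral_nonneg fun x => mul_self_nonneg _) fun h => hp ?_
  rw [eq_comm, integral_eq_zero_iff_of_nonneg (fun x => mul_self_nonneg _)
    ((memLp_eval hq p).integrable_mul (memLp_eval hq p))] at h
  have h2 : (fun x => p.eval x * p.eval x) =ᵐ[volume] fun _ => (0 : ℝ) :=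
    (ae_rationalWeight_iff hq).1 h
  have hc := p.continuous
  rw [Continuous.ae_eq_iff_eq volume (by fun_prop) continuous_const] at h2
  refine Polynomial.funext fun x => ?_
  simpa using congrFun h2 x

theorem isCompleteOrthogonalBasis_wr_hermiteH {n : ℕ} {φ : Fin n → ℕ}
    (h0 : ∀ x, (wr fun k => hermiteH (φ k)).eval x ≠ 0) :
    IsCompleteOrthogonalBasis (rationalWeight (wr fun k => hermiteH (φ k)))
      fun j : {j // j ∉ Set.range φ} =>
        wr (Fin.snoc (α := fun _ => ℝ[X]) (fun k => hermiteH (φ k)) (hermiteH j)) := by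
  refine isCompleteOrthogonalBasis_of_total _ (fun i => memLp_eval h0 _) (fun i j hij =>
    integral_wr_mul_wr_eq_zero φ h0 fun h => hij (Subtype.ext h)) (fun j => ?_)
    fun f hf hfj => ?_
  · refine integral_eval_mul_self_pos h0 (wr_snoc_ne_zero _ (h0 0) fun hmem => j.2 ?_)
    rw [show (fun k => hermiteH (φ k)) = hermiteH ∘ φ from rfl, Set.range_comp] at hmem
    by_contra hj
    exact linearIndependent_hermiteH.notMem_span_image hj hmem
  · obtain ⟨c, -, hwr⟩ := exists_wr_snoc_eq_sum fun k => hermiteH (φ k)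
    have hall : ∀ p : ℝ[X], ∫ x, f x * (wr (Fin.snoc (α := fun _ => ℝ[X])
        (fun k => hermiteH (φ k)) p)).eval x ∂rationalWeight (wr fun k => hermiteH (φ k)) = 0 := by
      intro p
      have hp : p ∈ Submodule.span ℝ (Set.range hermiteH) := by
        rw [span_hermiteH]; trivial
      have hint := fun p => hf.integrable_mul (memLp_eval h0 p)
      induction hp using Submodule.span_induction with
      | mem p hp =>
        obtain ⟨j, rfl⟩ := hp
        -- For an index already present the Wronskian has a repeated column and vanishes.
        by_cases hj : j ∈ Set.range φ
        · obtain ⟨k, rfl⟩ := hj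
          simp [wr_snoc_self (fun k => hermiteH (φ k)) k]
        · exact hfj ⟨j, hj⟩
      | zero => simp [hwr]
      | add p q _ _ hp hq =>
        have h1 : ∀ x, f x * (wr (Fin.snoc (α := fun _ => ℝ[X])
            (fun k => hermiteH (φ k)) (p + q))).eval x =
            f x * (wr (Fin.snoc (α := fun _ => ℝ[X]) (fun k => hermiteH (φ k)) p)).eval x +
            f x * (wr (Fin.snoc (α := fun _ => ℝ[X]) (fun k => hermiteH (φ k)) q)).eval x := by
          intro x
          simp only [hwr, iterate_map_add, mul_add, Finset.sum_add_distrib, eval_add]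
        simp only [h1]
        exact (integral_add (hint _) (hint _)).trans (by
          simp only [Pi.mul_apply, hp, hq, add_zero])
      | smul a p _ hp =>
        have h1 : ∀ x, f x * (wr (Fin.snoc (α := fun _ => ℝ[X])
            (fun k => hermiteH (φ k)) (a • p))).eval x =
            a * (f x * (wr (Fin.snoc (α := fun _ => ℝ[X])
              (fun k => hermiteH (φ k)) p)).eval x) := by
          intro x
          simp only [hwr, iterate_derivative_smul, mul_smul_comm, ← Finset.smul_sum, eval_smul,
            smul_eq_mul]
          ring
        simp only [h1]
        rw [integral_const_mul, hp, mul_zero]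
    refine ae_eq_zero_of_forall_integral_eq_zero h0 hf fun p => ?_
    obtain ⟨g, hg⟩ := exists_wr_snoc_eq (fun k => hermiteH (φ k)) p
    rw [← hg, hall]

/-! ### The Hermite operator on a half-line. -/

/-- The Hermite operator `p ↦ 2 x p' - p''` shifted by `e`. -/
def hermiteOp (e : ℝ) : Module.End ℝ ℝ[X] where
  toFun p := 2 * X * derivative p - derivative (derivative p) - C e * p
  map_add' p q := by simp only [derivative_add]; ring
  map_smul' c p := by simp only [derivative_smul, RingHom.id_apply]; simp only [smul_eq_C_mul]; ring

theorem hermiteOp_apply (e : ℝ) (p : ℝ[X]) :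
    hermiteOp e p = 2 * X * derivative p - derivative (derivative p) - C e * p := rfl

theorem hermiteOp_hermiteH (e : ℝ) (n : ℕ) :
    hermiteOp e (hermiteH n) = (2 * (n : ℝ) - e) • hermiteH n := by
  rw [hermiteOp_apply, derivative_derivative_hermiteH, smul_eq_C_mul, C_sub]
  ring

theorem prod_hermiteOp_hermiteH (es : List ℝ) (n : ℕ) :
    (es.map hermiteOp).prod (hermiteH n) =
      (es.map fun e => 2 * (n : ℝ) - e).prod • hermiteH n := by
  induction es with
  | nil => simp
  | cons e es ih =>
    simp only [List.map_cons, List.prod_cons, Module.End.mul_apply]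
    rw [ih, map_smul, hermiteOp_hermiteH, smul_smul, mul_comm]

theorem pow_dvd_hermiteOp {a e : ℝ} {n : ℕ} {p : ℝ[X]} (h : (X - C a) ^ (n + 2) ∣ p) :
    (X - C a) ^ n ∣ hermiteOp e p := by
  have h1 : (X - C a) ^ n ∣ derivative p :=
    (pow_dvd_pow _ (by omega)).trans (pow_sub_dvd_iterate_derivative_of_pow_dvd 1 h)
  have h2 : (X - C a) ^ n ∣ derivative (derivative p) :=
    (pow_dvd_pow _ (by omega)).trans (pow_sub_dvd_iterate_derivative_of_pow_dvd 2 h)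
  exact ((h1.mul_left _).sub h2).sub (((pow_dvd_pow _ (by omega)).trans h).mul_left _)

theorem pow_dvd_prod_hermiteOp {a : ℝ} {n : ℕ} (es : List ℝ) {p : ℝ[X]}
    (h : (X - C a) ^ (n + 2 * es.length) ∣ p) :
    (X - C a) ^ n ∣ (es.map hermiteOp).prod p := by
  induction es generalizing n with
  | nil => simpa using h
  | cons e es ih =>
    simp only [List.map_cons, List.prod_cons, Module.End.mul_apply]
    refine pow_dvd_hermiteOp (ih ?_)
    rw [List.length_cons] at h
    rwa [show n + 2 + 2 * es.length = n + 2 * (es.length + 1) by ring]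

/-- The inner product of two polynomials on `(a, ∞)` with respect to the Gaussian weight. -/
def halfInner (a : ℝ) (p r : ℝ[X]) : ℝ :=
  ∫ x in Set.Ioi a, (p * r).eval x * Real.exp (-x ^ 2)

theorem halfInner_smul_right (a c : ℝ) (p r : ℝ[X]) :
    halfInner a p (c • r) = c * halfInner a p r := by
  rw [halfInner, halfInner, ← integral_const_mul]
  simp only [mul_smul_comm, eval_smul, smul_eq_mul, mul_assoc]

/-- Green's formula: the boundary term at `a` involves only `p` and `p'`, which vanish there. -/
theorem halfInner_hermiteOp {a : ℝ} {p : ℝ[X]} (h : (X - C a) ^ 2 ∣ p) (e : ℝ) (r : ℝ[X]) :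
    halfInner a (hermiteOp e p) r = halfInner a p (hermiteOp e r) := by
  have hp0 : p.eval a = 0 := by
    obtain ⟨q, rfl⟩ := h
    simp
  have hp1 : (derivative p).eval a = 0 := by
    obtain ⟨q, hq⟩ := pow_sub_dvd_iterate_derivative_of_pow_dvd 1 h
    have hq : derivative p = (X - C a) ^ 1 * q := hq
    rw [hq]
    simp
  rw [halfInner, halfInner, ← sub_eq_zero, ← integral_sub
    (integrable_eval_mul_exp_neg_sq _).integrableOn
    (integrable_eval_mul_exp_neg_sq _).integrableOn]
  have hd : ∀ x : ℝ, HasDerivAt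
      (fun x => (p * derivative r - derivative p * r).eval x * Real.exp (-x ^ 2))
      ((hermiteOp e p * r).eval x * Real.exp (-x ^ 2)
        - (p * hermiteOp e r).eval x * Real.exp (-x ^ 2)) x := by
    intro x
    have h1 : HasDerivAt (fun x : ℝ => Real.exp (-x ^ 2)) (Real.exp (-x ^ 2) * (-(2 * x))) x := by
      simpa using ((hasDerivAt_pow 2 x).neg).exp
    refine (((p * derivative r - derivative p * r).hasDerivAt x).mul h1).congr_deriv ?_
    simp only [hermiteOp_apply, derivative_sub, derivative_mul, eval_sub, eval_add, eval_mul,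
      eval_X, eval_C, eval_ofNat]
    ring
  have hi : IntegrableOn (fun x => (hermiteOp e p * r).eval x * Real.exp (-x ^ 2)
        - (p * hermiteOp e r).eval x * Real.exp (-x ^ 2)) (Set.Ioi a) :=
    ((integrable_eval_mul_exp_neg_sq _).sub (integrable_eval_mul_exp_neg_sq _)).integrableOn
  have := integral_Ioi_of_hasDerivAt_of_tendsto' (a := a) (fun x _ => hd x) hi
    (tendsto_zero_of_hasDerivAt_of_integrableOn_Ioi (a := a) (fun x _ => hd x) hi
      (integrable_eval_mul_exp_neg_sq _).integrableOn)
  rw [this]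
  simp [hp0, hp1]

/-- Each factor lowers the order of vanishing at `a` by at most two, so order `2 * es.length` leaves
a double zero for every integration by parts. -/
theorem halfInner_prod_hermiteOp {a : ℝ} (es : List ℝ) {p : ℝ[X]}
    (h : (X - C a) ^ (2 * es.length) ∣ p) (r : ℝ[X]) :
    halfInner a ((es.map hermiteOp).prod p) r =
      halfInner a p ((es.reverse.map hermiteOp).prod r) := by
  induction es generalizing r with
  | nil => simp
  | cons e es ih =>
    rw [List.length_cons] at h
    simp only [List.map_cons, List.prod_cons, Module.End.mul_apply, List.reverse_cons,
      List.map_append, List.prod_append, List.map_nil, List.prod_nil, mul_one]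
    rw [halfInner_hermiteOp, ih ((pow_dvd_pow _ (by omega)).trans h)]
    refine pow_dvd_prod_hermiteOp es ?_
    rwa [show 2 + 2 * es.length = 2 * (es.length + 1) by ring]

theorem halfInner_prod_hermiteOp_hermiteH {a : ℝ} (es : List ℝ) {p : ℝ[X]}
    (h : (X - C a) ^ (2 * es.length) ∣ p) (n : ℕ) :
    halfInner a ((es.map hermiteOp).prod p) (hermiteH n) =
      (es.map fun e => 2 * (n : ℝ) - e).prod * halfInner a p (hermiteH n) := by
  rw [halfInner_prod_hermiteOp es h, prod_hermiteOp_hermiteH, halfInner_smul_right,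
    List.map_reverse, List.prod_reverse]

theorem wr_fin_zero (f : Fin 0 → ℝ[X]) : wr f = 1 := by simp [wr]

/-! ### Hermite expansions of truncated polynomials. -/

/-- The case of no seed functions, where the Wronskian is `1`. -/
theorem exists_hilbertBasis_hermiteH :
    ∃ b : HilbertBasis ℕ ℝ (Lp ℝ 2 (rationalWeight 1)), ∀ n, ∃ c : ℝ, 0 < c ∧
      (b n : ℝ → ℝ) =ᵐ[rationalWeight 1] fun x => c * (hermiteH n).eval x := by
  have h := isCompleteOrthogonalBasis_wr_hermiteH (φ := (Fin.elim0 : Fin 0 → ℕ))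
    (by simp [wr_fin_zero])
  rw [wr_fin_zero] at h
  obtain ⟨b, hb⟩ := h
  have hmem : ∀ n : ℕ, n ∉ Set.range (Fin.elim0 : Fin 0 → ℕ) := fun n ⟨i, _⟩ => i.elim0
  let e := (Equiv.subtypeUnivEquiv hmem).symm
  refine ⟨HilbertBasis.mk (b.orthonormal.comp e e.injective) ?_, fun n => ?_⟩
  · rw [EquivLike.range_comp, b.dense_span]
  obtain ⟨c, hc, h⟩ := hb ⟨n, hmem n⟩
  refine ⟨c, hc, ?_⟩
  rw [HilbertBasis.coe_mk]
  simpa [e, wr, Matrix.det_unique, Fin.snoc] using h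

theorem eq_zero_of_ae_eval_eq_zero {p : ℝ[X]} {s : Set ℝ} (hs : volume s ≠ 0)
    (h : ∀ᵐ x, x ∈ s → p.eval x = 0) : p = 0 := by
  by_contra hp
  refine hs ?_
  have hr : ∀ᵐ x : ℝ, ¬ p.IsRoot x := by
    rw [ae_iff]
    simpa using (finite_setOfPred_isRoot hp).measure_zero volume
  rw [← compl_compl s]
  refine (mem_ae_iff).1 ?_
  filter_upwards [h, hr] with x h1 h2 h3
  exact h2 (h1 h3)

theorem eval_one_ne_zero (x : ℝ) : (1 : ℝ[X]).eval x ≠ 0 := by simp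

/-- The restriction of a polynomial to `(a, ∞)` as a square-integrable function. -/
def halfLp (a : ℝ) (p : ℝ[X]) : Lp ℝ 2 (rationalWeight 1) :=
  ((memLp_eval eval_one_ne_zero p).indicator (measurableSet_Ioi (a := a))).toLp _

theorem coeFn_halfLp (a : ℝ) (p : ℝ[X]) :
    halfLp a p =ᵐ[rationalWeight 1] (Set.Ioi a).indicator fun x => p.eval x :=
  MemLp.coeFn_toLp _

theorem inner_halfLp (a c : ℝ) (p r : ℝ[X]) {f : Lp ℝ 2 (rationalWeight 1)}
    (hf : ∀ᵐ x ∂rationalWeight 1, x ∈ Set.Ioi a → f x = c * r.eval x) :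
    inner ℝ (halfLp a p) f = c * halfInner a p r := by
  have h1 : inner ℝ (halfLp a p) f = ∫ x, (Set.Ioi a).indicator
      (fun x => c * (p * r).eval x) x ∂rationalWeight 1 := by
    rw [L2.inner_def]
    refine integral_congr_ae ?_
    filter_upwards [coeFn_halfLp a p, hf] with x h1 h2
    rw [h1]
    by_cases hx : x ∈ Set.Ioi a
    · rw [Set.indicator_of_mem hx, Set.indicator_of_mem hx, h2 hx, eval_mul]
      simp
      ring
    · rw [Set.indicator_of_notMem hx, Set.indicator_of_notMem hx, inner_zero_left]
  rw [h1, integral_rationalWeight, halfInner, ← integral_const_mul,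
    ← integral_indicator measurableSet_Ioi]
  refine integral_congr_ae (ae_of_all _ fun x => ?_)
  by_cases hx : x ∈ Set.Ioi a
  · simp only [Set.indicator_of_mem hx, eval_one]
    ring
  · simp only [Set.indicator_of_notMem hx, mul_zero]

/-- Parseval for the truncations to `(a, ∞)`; `d n` is the squared normalizing constant of `hermiteH
n`. -/
theorem hasSum_halfInner (a : ℝ) : ∃ d : ℕ → ℝ, (∀ n, 0 < d n) ∧ ∀ p r : ℝ[X],
    HasSum (fun n => d n * (halfInner a p (hermiteH n) * halfInner a r (hermiteH n)))
      (halfInner a p r) := by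
  obtain ⟨b, hb⟩ := exists_hilbertBasis_hermiteH
  choose c hc hbc using hb
  refine ⟨fun n => c n ^ 2, fun n => pow_pos (hc n) 2, fun p r => ?_⟩
  have hin : ∀ (p : ℝ[X]) n, inner ℝ (halfLp a p) (b n) = c n * halfInner a p (hermiteH n) :=
    fun p n => inner_halfLp a (c n) p _ (by filter_upwards [hbc n] with x hx _ using hx)
  have h := b.hasSum_inner_mul_inner (halfLp a p) (halfLp a r)
  rw [inner_halfLp a 1 p r (by
    filter_upwards [coeFn_halfLp a r] with x hx h
    rw [hx, Set.indicator_of_mem h, one_mul]), one_mul] at h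
  refine h.congr_fun fun n => ?_
  rw [real_inner_comm (halfLp a r), hin, hin]
  ring

/-- A finite Hermite expansion makes the truncation of `p` a.e. a polynomial. It vanishes on `(-∞,
a]`, hence everywhere, and then so does `p`. -/
theorem eq_zero_of_halfInner_eq_zero {a : ℝ} {p : ℝ[X]} {s : Set ℕ} (hs : s.Finite)
    (h : ∀ n ∉ s, halfInner a p (hermiteH n) = 0) : p = 0 := by
  obtain ⟨b, hb⟩ := exists_hilbertBasis_hermiteH
  choose c hc hbc using hb
  have hsum := b.hasSum_repr (halfLp a p)
  have hfin := hsum.unique (hasSum_sum_of_ne_finset_zero (s := hs.toFinset) fun n hn => by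
    rw [b.repr_apply_apply, real_inner_comm, inner_halfLp a (c n) p (hermiteH n)
      (by filter_upwards [hbc n] with x hx _ using hx),
      h n (fun h => hn (hs.mem_toFinset.2 h)), mul_zero, zero_smul])
  have hmem : halfLp a p ∈ Submodule.span ℝ (Set.range b) := by
    rw [hfin]
    exact Submodule.sum_mem _ fun n _ => Submodule.smul_mem _ _ (Submodule.subset_span ⟨n, rfl⟩)
  obtain ⟨q, -, hq⟩ := exists_polynomial_of_mem_span (S := ⊤) (fun n => ⟨c n • hermiteH n, trivial,
    by filter_upwards [hbc n] with x hx
       rw [hx, eval_smul, smul_eq_mul]⟩) hmem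
  have hae : ∀ᵐ x, (Set.Ioi a).indicator (fun x => p.eval x) x = q.eval x := by
    rw [← ae_rationalWeight_iff eval_one_ne_zero]
    filter_upwards [hq, coeFn_halfLp a p] with x h1 h2
    rw [← h1, h2]
  have hq0 : q = 0 := by
    refine eq_zero_of_ae_eval_eq_zero (s := Set.Iic a) (by simp) ?_
    filter_upwards [hae] with x hx hxa
    rw [← hx, Set.indicator_of_notMem (by simpa using hxa)]
  refine eq_zero_of_ae_eval_eq_zero (s := Set.Ioi a) (by simp) ?_
  filter_upwards [hae] with x hx hxa
  rw [Set.indicator_of_mem hxa, hq0, eval_zero] at hx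
  exact hx

/-- No integer lies strictly between `k` and `k + 1`, so each factor `(2n - 2k)(2n - 2k - 2)` is
nonnegative. -/
theorem prod_mul_prod_nonneg (ks : List ℕ) (n : ℕ) :
    0 ≤ ((ks.map fun k : ℕ => 2 * (k : ℝ)).map fun e => 2 * (n : ℝ) - e).prod *
      ((ks.map fun k : ℕ => 2 * (k : ℝ) + 2).map fun e => 2 * (n : ℝ) - e).prod := by
  rw [List.map_map, List.map_map, ← List.prod_map_mul]
  refine List.prod_nonneg fun x hx => ?_
  obtain ⟨k, -, rfl⟩ := List.mem_map.1 hx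
  simp only [Function.comp_apply]
  rcases le_or_gt n k with h | h
  · have : (n : ℝ) ≤ k := by exact_mod_cast h
    exact mul_nonneg_of_nonpos_of_nonpos (by linarith) (by linarith)
  · have : (k : ℝ) + 1 ≤ n := by exact_mod_cast h
    exact mul_nonneg (by linarith) (by linarith)

/-- A Wronskian of Hermite polynomials whose indices form disjoint pairs of consecutive integers
has no real zeros. -/
theorem wr_hermiteH_eval_ne_zero {n : ℕ} {φ : Fin n → ℕ} (hφ : Function.Injective φ)
    {ks : List ℕ} (hlen : 2 * ks.length ≤ n)
    (hks : ∀ j, j ∈ Set.range φ ↔ ∃ k ∈ ks, j = k ∨ j = k + 1) (a : ℝ) :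
    (wr fun k => hermiteH (φ k)).eval a ≠ 0 := by
  intro h0
  let M : Matrix (Fin n) (Fin n) ℝ :=
    Matrix.of fun i j => (derivative^[(i : ℕ)] (hermiteH (φ j))).eval a
  have hM : M.det = 0 := by
    rw [wr, ← coe_evalRingHom, RingHom.map_det] at h0
    rw [← h0]
    congr 1
  obtain ⟨c, hc0, hc⟩ := Matrix.exists_mulVec_eq_zero_iff.2 hM
  -- A kernel vector of the singular Wronskian matrix at `a` gives `f` with a zero of order `n`
  -- there.
  set f := ∑ k, c k • hermiteH (φ k) with hf
  have hdvd : (X - C a) ^ n ∣ f := pow_X_sub_C_dvd_of_iterate_derivative fun i hi => by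
    have := congrFun hc ⟨i, hi⟩
    simp only [Matrix.mulVec, dotProduct, M, Matrix.of_apply, Pi.zero_apply] at this
    simp only [hf, iterate_derivative_sum, iterate_derivative_smul, eval_finsetSum, eval_smul,
      smul_eq_mul]
    rw [← this]
    exact Finset.sum_congr rfl fun k _ => mul_comm _ _
  have hf0 : f ≠ 0 := fun h => hc0 (funext fun k =>
    Fintype.linearIndependent_iff.1 (linearIndependent_hermiteH.comp φ hφ) c h k)
  -- The lower and upper eigenvalues of the pairs. Each list needs vanishing of order only `2 *
  -- ks.length ≤ n`, which is why the full product is split.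
  let es₁ : List ℝ := ks.map fun k : ℕ => 2 * (k : ℝ)
  let es₂ : List ℝ := ks.map fun k : ℕ => 2 * (k : ℝ) + 2
  have hdvd₁ : (X - C a) ^ (2 * es₁.length) ∣ f := (pow_dvd_pow _ (by simpa [es₁])).trans hdvd
  have hdvd₂ : (X - C a) ^ (2 * es₂.length) ∣ f := (pow_dvd_pow _ (by simpa [es₂])).trans hdvd
  have hzero : ∀ k : Fin n, (es₁.map fun e => 2 * (φ k : ℝ) - e).prod = 0 ∨
      (es₂.map fun e => 2 * (φ k : ℝ) - e).prod = 0 := by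
    intro k
    obtain ⟨m, hm, h | h⟩ := (hks (φ k)).1 ⟨k, rfl⟩
    · left
      refine List.prod_eq_zero (List.mem_map.2 ⟨2 * (m : ℝ), List.mem_map.2 ⟨m, hm, rfl⟩, ?_⟩)
      rw [h, sub_self]
    · right
      refine List.prod_eq_zero (List.mem_map.2 ⟨2 * (m : ℝ) + 2, List.mem_map.2 ⟨m, hm, rfl⟩, ?_⟩)
      rw [h]
      push_cast
      ring
  have hnz : ∀ j ∉ Set.range φ, (es₁.map fun e => 2 * (j : ℝ) - e).prod ≠ 0 ∧
      (es₂.map fun e => 2 * (j : ℝ) - e).prod ≠ 0 := by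
    intro j hj
    constructor
    · refine List.prod_ne_zero fun h => hj ?_
      simp only [es₁, List.map_map, List.mem_map, Function.comp_apply] at h
      obtain ⟨k, hk, h⟩ := h
      refine (hks j).2 ⟨k, hk, Or.inl ?_⟩
      have : (j : ℝ) = k := by linarith
      exact_mod_cast this
    · refine List.prod_ne_zero fun h => hj ?_
      simp only [es₂, List.map_map, List.mem_map, Function.comp_apply] at h
      obtain ⟨k, hk, h⟩ := h
      refine (hks j).2 ⟨k, hk, Or.inr ?_⟩
      have : (j : ℝ) = (k + 1 : ℕ) := by push_cast; linarith
      exact_mod_cast this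
  -- The operators `L₁` are moved onto the other factor, where `L₁ L₂ f = 0`.
  have hFG : halfInner a ((es₁.map hermiteOp).prod f) ((es₂.map hermiteOp).prod f) = 0 := by
    rw [halfInner_prod_hermiteOp es₁ hdvd₁]
    have : (es₁.reverse.map hermiteOp).prod ((es₂.map hermiteOp).prod f) = 0 := by
      simp only [hf, map_sum, map_smul]
      refine Finset.sum_eq_zero fun k _ => ?_
      rw [prod_hermiteOp_hermiteH, map_smul, prod_hermiteOp_hermiteH, List.map_reverse,
        List.prod_reverse]
      rcases hzero k with h | h <;> simp [h]
    rw [this]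
    simp [halfInner]
  obtain ⟨d, hd, hsum⟩ := hasSum_halfInner a
  have hterm : ∀ j ∉ Set.range φ, halfInner a f (hermiteH j) = 0 := by
    intro j hj
    have hs := hsum ((es₁.map hermiteOp).prod f) ((es₂.map hermiteOp).prod f)
    simp only [halfInner_prod_hermiteOp_hermiteH es₁ hdvd₁,
      halfInner_prod_hermiteOp_hermiteH es₂ hdvd₂, hFG] at hs
    -- The Parseval sum has nonnegative terms and total `0`, so each term vanishes.
    rw [hasSum_zero_iff_of_nonneg] at hs
    · have := congrFun hs j
      simpa [(hd j).ne', (hnz j hj).1, (hnz j hj).2] using this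
    · intro j
      have := mul_nonneg (mul_nonneg (hd j).le (prod_mul_prod_nonneg ks j))
        (sq_nonneg (halfInner a f (hermiteH j)))
      refine this.trans_eq ?_
      simp only [es₁, es₂]
      ring
  exact hf0 (eq_zero_of_halfInner_eq_zero (Set.finite_range φ) hterm)

/-! ### Gap sequences of Adler partitions and the conclusion. -/

theorem injective_gap {lam : List ℕ} (h : IsPartition lam) : Function.Injective (gap lam) := by
  have : StrictMono (gap lam) := fun i j hij => by
    have := List.pairwise_iff_get.1 h i j hij
    have hij : (i : ℕ) < j := hij
    simp only [gap]
    omega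
  exact this.injective

theorem length_double (mu : List ℕ) : (double mu).length = 2 * mu.length := by
  induction mu with
  | nil => rfl
  | cons a mu ih => simp [double] at ih ⊢; omega

theorem getElem?_double (mu : List ℕ) (i : ℕ) : (double mu)[i]? = mu[i / 2]? := by
  induction mu generalizing i with
  | nil => simp [double]
  | cons a mu ih =>
    have h : double (a :: mu) = a :: a :: double mu := rfl
    rw [h]
    match i with
    | 0 => simp
    | 1 => simp
    | i + 2 => simp [ih]

theorem isPartition_double {mu : List ℕ} (h : IsPartition mu) : IsPartition (double mu) := by
  induction mu with
  | nil => exact List.Pairwise.nil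
  | cons a mu ih =>
    have h' := List.pairwise_cons.1 h
    have hall : ∀ b ∈ double mu, a ≤ b := fun b hb => by
      obtain ⟨c, hc, hbc⟩ := List.mem_flatMap.1 hb
      have : b = c := by simpa using hbc
      exact this ▸ h'.1 c hc
    refine List.pairwise_cons.2 ⟨fun b hb => ?_, List.pairwise_cons.2 ⟨hall, ih h'.2⟩⟩
    rcases List.mem_cons.1 hb with rfl | hb
    · exact le_rfl
    · exact hall b hb

theorem hermiteWr_double_eval_ne_zero {mu : List ℕ} (h : IsPartition mu) (x : ℝ) :
    (hermiteWr (double mu)).eval x ≠ 0 := by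
  have hlen := length_double mu
  have hget : ∀ (i : Fin (double mu).length) (h : (i : ℕ) / 2 < mu.length),
      (double mu).get i = mu.get ⟨(i : ℕ) / 2, h⟩ := by
    intro i h
    have := getElem?_double mu i
    rw [List.getElem?_eq_getElem i.2, List.getElem?_eq_getElem h] at this
    exact Option.some.inj this
  refine wr_hermiteH_eval_ne_zero (injective_gap (isPartition_double h))
    -- Positions `2i` and `2i + 1` of the double partition have gaps `μ_i + 2i` and `μ_i + 2i + 1`,
    -- counting from `i = 0`.
    (ks := List.ofFn fun i : Fin mu.length => mu.get i + 2 * i) (by simp [hlen]) (fun j => ?_) x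
  simp only [List.mem_ofFn, Set.mem_range]
  constructor
  · rintro ⟨i, rfl⟩
    have hi : (i : ℕ) / 2 < mu.length := by have := i.2; omega
    refine ⟨_, ⟨⟨(i : ℕ) / 2, hi⟩, rfl⟩, ?_⟩
    simp only [gap, hget i hi]
    omega
  · rintro ⟨_, ⟨i, rfl⟩, rfl | rfl⟩
    · refine ⟨⟨2 * i, by have := i.2; omega⟩, ?_⟩
      rw [gap, hget _ (by simp)]
      simp
    · refine ⟨⟨2 * i + 1, by have := i.2; omega⟩, ?_⟩
      have h2 : (2 * (i : ℕ) + 1) / 2 = i := by omega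
      rw [gap, hget _ (by simp only [h2]; exact i.2)]
      simp only [h2]
      rfl

/-- A leading zero shifts all gaps by one and adjoins `H_0 = 1`. The Wronskian then becomes that of
the derivatives, and `H_{n+1}' = 2(n+1) H_n` shifts the gaps back. -/
theorem hermiteWr_zero_cons (lam : List ℕ) : ∃ c : ℝ, c ≠ 0 ∧
    hermiteWr (0 :: lam) = C c * hermiteWr lam := by
  refine ⟨∏ i, (2 * ((gap lam i : ℝ) + 1)), Finset.prod_ne_zero_iff.2 fun i _ => by positivity, ?_⟩
  have h1 : (fun i => hermiteH (gap (0 :: lam) i)) =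
      (Fin.cons 1 (fun i => hermiteH (gap lam i + 1)) : Fin (lam.length + 1) → ℝ[X]) := by
    funext i
    refine Fin.cases ?_ (fun i => ?_) i
    · rfl
    · rfl
  have h2 : hermiteWr (0 :: lam) =
      wr (Fin.cons 1 (fun i => hermiteH (gap lam i + 1)) : Fin (lam.length + 1) → ℝ[X]) :=
    congrArg (wr (n := lam.length + 1)) h1
  rw [h2, wr_one_cons]
  simp only [derivative_hermiteH_succ]
  rw [wr_mul_C]
  rfl

theorem hermiteWr_eval_ne_zero {lam : List ℕ} (h : IsAdlerPartition lam) (x : ℝ) :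
    (hermiteWr lam).eval x ≠ 0 := by
  obtain ⟨z, mu, hmu, rfl⟩ := h
  induction z with
  | zero => simpa using hermiteWr_double_eval_ne_zero hmu x
  | succ z ih =>
    rw [List.replicate_succ, List.cons_append]
    obtain ⟨c, hc, h⟩ := hermiteWr_zero_cons (List.replicate z 0 ++ double mu)
    rw [h, eval_mul, eval_C]
    exact mul_ne_zero hc ih

theorem isCompleteOrthogonalBasis_hermiteWrAdd {lam : List ℕ} (h : IsAdlerPartition lam) :
    IsCompleteOrthogonalBasis (weightMeasure lam)
      fun j : {j : ℕ // j ∉ gapSet lam} => hermiteWrAdd lam j :=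
  isCompleteOrthogonalBasis_wr_hermiteH (hermiteWr_eval_ne_zero h)

end

end XHermite

theorem mainTheorem5 :
    (∀ lam : List ℕ, XHermite.IsAdlerPartition lam →
      (∀ x : ℝ, (XHermite.hermiteWr lam).eval x ≠ 0) ∧
      (∀ p ∈ XHermite.exceptionalSubspace lam,
        MeasureTheory.MemLp (fun x : ℝ => p.eval x) 2 (XHermite.weightMeasure lam)) ∧
      Dense {f : MeasureTheory.Lp ℝ 2 (XHermite.weightMeasure lam) |
        ∃ p ∈ XHermite.exceptionalSubspace lam,
          ∀ᵐ x ∂(XHermite.weightMeasure lam), f x = p.eval x} ∧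
      XHermite.IsCompleteOrthogonalBasis (XHermite.weightMeasure lam)
        (fun j : {j : ℕ // j ∉ XHermite.gapSet lam} => XHermite.hermiteWrAdd lam j)) ∧
    (∀ mu : List ℕ, XHermite.IsPartition mu →
      XHermite.IsCompleteOrthogonalBasis (XHermite.weightMeasure (XHermite.double mu))
        (fun j : {j : ℕ // j ∉ XHermite.gapSet (XHermite.double mu)} =>
          XHermite.xHermite mu j)) := by
  refine ⟨fun lam h => ⟨XHermite.hermiteWr_eval_ne_zero h,
    fun p _ => XHermite.memLp_eval (XHermite.hermiteWr_eval_ne_zero h) p,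
    (XHermite.isCompleteOrthogonalBasis_hermiteWrAdd h).dense fun j =>
      Submodule.subset_span ⟨j, j.2, rfl⟩,
    XHermite.isCompleteOrthogonalBasis_hermiteWrAdd h⟩, fun mu h =>
    XHermite.isCompleteOrthogonalBasis_hermiteWrAdd ⟨0, mu, h, rfl⟩⟩
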